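/- Let $\Omega\subset\mathbb R$ be compact and convex, let $l\ge 1$, and let $\mathcal P^{ac}(\Omega)$ be the set of Borel probability measures on $\Omega$ that are absolutely continuous with respect to Lebesgue measure, endowed with the quadratic Wasserstein distance $$W_2(\rho,\mu)=\Big(\inf_{\gamma\in\Pi(\rho,\mu)}\int |x-y|^2\,d\gamma(x,y)\Big)^{1/2},$$ where $\Pi(\rho_1,\dots,\rho_l)$ denotes the set of probability measures on $\Omega^l$ with marginals $\rho_1,\dots,\rho_l$. Let $c:\Omega^l\to\mathbb R$ be a convex function of class $C^2$ on $\Omega^l$ such that $\partial_{ij}c\le 0$ on $\Omega^l$ for all $i\ne j$, and for $\rho_1,\dots,\rho_l\in\mathcal P^{ac}(\Omega)$ put $$\mathcal W_c(\rho_1,\dots,\rho_l)=\inf\Big\{\int_{\Omega^l}c\,d\gamma:\ \gamma\in\Pi(\rho_1,\dots,\rho_l)\Big\}.$$ Then $\mathcal W_c$ is geodesically convex on $\mathcal P^{ac}(\Omega)^l$ (that is, $\lambda$-geodesically convex with $\lambda=0$): if $t\in[0,1]\mapsto\mu_i^t\in\mathcal P^{ac}(\Omega)$ is, for each $i=1,\dots,l$,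 a constant speed geodesic, i.e. $W_2(\mu_i^s,\mu_i^t)=|t-s|\,W_2(\mu_i^0,\mu_i^1)$ for all $s,t\in[0,1]$, then for all $t\in[0,1]$ $$\mathcal W_c(\mu_1^t,\dots,\mu_l^t)\le(1-t)\,\mathcal W_c(\mu_1^0,\dots,\mu_l^0)+t\,\mathcal W_c(\mu_1^1,\dots,\mu_l^1).$$ -/

import Mathlib

open MeasureTheory

noncomputable section

namespace OptTransport

/-- The absolutely continuous (with respect to Lebesgue measure) probability measures on
`Ω ⊆ ℝ`, regarded as probability measures on `ℝ` concentrated on `Ω`. -/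
def ProbAC (Ω : Set ℝ) : Set (ProbabilityMeasure ℝ) :=
  {μ | (μ : Measure ℝ) Ωᶜ = 0 ∧ (μ : Measure ℝ) ≪ volume}

/-- Transport plans between `μ` and `ν`. -/
def Plans (μ ν : ProbabilityMeasure ℝ) : Set (ProbabilityMeasure (ℝ × ℝ)) :=
  {γ | (γ : Measure (ℝ × ℝ)).map Prod.fst = (μ : Measure ℝ) ∧
    (γ : Measure (ℝ × ℝ)).map Prod.snd = (ν : Measure ℝ)}

/-- The quadratic Wasserstein distance. It is used for measures on a bounded set only, so that
all the integrals are finite. -/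
def W2 (μ ν : ProbabilityMeasure ℝ) : ℝ :=
  Real.sqrt (sInf ((fun γ : ProbabilityMeasure (ℝ × ℝ) =>
    ∫ p, |p.1 - p.2| ^ 2 ∂(γ : Measure (ℝ × ℝ))) '' Plans μ ν))

/-- Multi-marginal transport plans with marginals `ρ 0, …, ρ (l - 1)`. -/
def MultiPlans {l : ℕ} (ρ : Fin l → ProbabilityMeasure ℝ) :
    Set (ProbabilityMeasure (Fin l → ℝ)) :=
  {γ | ∀ i, (γ : Measure (Fin l → ℝ)).map (fun x => x i) = (ρ i : Measure ℝ)}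

/-- The product `Ω ^ l`. -/
def cube (Ω : Set ℝ) (l : ℕ) : Set (Fin l → ℝ) := Set.univ.pi fun _ => Ω

/-- The multi-marginal transport functional with cost `c : Ω ^ l → ℝ` (the values of `c` outside
`Ω ^ l` play no role). The set of plans is never empty (it contains the product measure), and
for `c` continuous on `Ω ^ l` and `Ω` compact the infimum is taken over a bounded set. -/
def multiMarginal (Ω : Set ℝ) {l : ℕ} (c : (Fin l → ℝ) → ℝ) (ρ : Fin l → ProbAC Ω) : ℝ :=
  sInf ((fun γ : ProbabilityMeasure (Fin l → ℝ) =>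
    ∫ x in cube Ω l, c x ∂(γ : Measure (Fin l → ℝ))) '' MultiPlans (fun i => (ρ i).1))

/-- Constant speed geodesics `[0, 1] → ProbAC Ω` for the distance `W2` (the values of the curve
outside `[0, 1]` play no role). -/
def IsConstSpeedGeodesic {Ω : Set ℝ} (μ : ℝ → ProbAC Ω) : Prop :=
  ∀ s ∈ Set.Icc (0 : ℝ) 1, ∀ t ∈ Set.Icc (0 : ℝ) 1,
    W2 (μ s).1 (μ t).1 = |t - s| * W2 (μ 0).1 (μ 1).1

/-- `κ`-geodesic convexity of a real functional on the product of `l` copies of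
`(ProbAC Ω, W2)`; the last term is the square of the product distance. -/
def IsGeodesicallyConvex {Ω : Set ℝ} {l : ℕ} (κ : ℝ) (W : (Fin l → ProbAC Ω) → ℝ) : Prop :=
  ∀ μ : Fin l → ℝ → ProbAC Ω, (∀ i, IsConstSpeedGeodesic (μ i)) →
    ∀ t ∈ Set.Icc (0 : ℝ) 1,
      W (fun i => μ i t) ≤ (1 - t) * W (fun i => μ i 0) + t * W (fun i => μ i 1)
        - κ / 2 * t * (1 - t) * ∑ i, W2 (μ i 0).1 (μ i 1).1 ^ 2

/-- The `i`-th partial derivative of `f` on the set `S` (one-sided at boundary points). -/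
def partialWithin {l : ℕ} (S : Set (Fin l → ℝ)) (i : Fin l) (f : (Fin l → ℝ) → ℝ)
    (x : Fin l → ℝ) : ℝ :=
  fderivWithin ℝ f S x (Pi.single i 1)

end OptTransport

end

/-!
In one dimension both transport problems are solved explicitly by quantile functions, and this
turns the claim into the convexity of `c`.

Nonpositive mixed second derivatives make `c` submodular
(`submodularOn_of_partialWithin_nonpos`), and for a submodular cost the comonotone coupling, the
law of `(Q₁ s, …, Q_l s)` with `s` uniform on `[0, 1]` and `Qᵢ` the quantile function of `ρᵢ`, is
optimal (`integral_comonotone_le`, `integral_quantile_le`). Optimality rests on a discrete duality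
argument: a submodular function on `ℕ ^ l` dominates a separable function, with equality on the
diagonal (`exists_potentials`). The separable function collects the increments of
the submodular one along a staircase path close to the diagonal, and a single use of submodularity compares each of them with
the increment along the truncated path that ends at a given point. Sampling the quantile functions
on the grid `{k / n}`, integrating and letting `n → ∞` gives the optimality, without any regularity
of the quantile functions beyond monotonicity. Absolute continuity enters through the probability
integral transform `map_cdf`: if `X` has law `ρ` with distribution function `F`, then `F X` is
uniform and `X = Q (F X)` almost surely.

Hence `multiMarginal` is `∫ c (Q₁ s, …, Q_l s) ds`, and, since the quadratic cost `|x - y| ^ 2` is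
submodular too, `W2` is the `L²` distance of the quantile functions (`W2_sq_eq_integral_quantile`).
A constant speed geodesic satisfies equality in the triangle inequality of a Hilbert space, so its
quantile functions are `(1 - t) Q⁰ + t Q¹` (`IsConstSpeedGeodesic.quantile_ae_eq`), and integrating
the convexity inequality of `c` finishes the proof.
-/

namespace OptTransport

/-! ### Submodularity from mixed second derivatives -/

/-- `f` is submodular on `S`: `f (x ⊓ y) + f (x ⊔ y) ≤ f x + f y` for `x, y ∈ S`. -/
def SubmodularOn {α : Type*} [Lattice α] (S : Set α) (f : α → ℝ) : Prop :=
  ∀ x ∈ S, ∀ y ∈ S, f (x ⊓ y) + f (x ⊔ y) ≤ f x + f y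

lemma mem_cube {Ω : Set ℝ} {l : ℕ} {x : Fin l → ℝ} : x ∈ cube Ω l ↔ ∀ i, x i ∈ Ω := by
  simp [cube]

lemma convex_cube {Ω : Set ℝ} (hΩ : Convex ℝ Ω) (l : ℕ) : Convex ℝ (cube Ω l) :=
  convex_pi fun _ _ => hΩ

lemma inf_mem_cube {a b : ℝ} {l : ℕ} {x y : Fin l → ℝ} (hx : x ∈ cube (Set.Icc a b) l)
    (hy : y ∈ cube (Set.Icc a b) l) : x ⊓ y ∈ cube (Set.Icc a b) l :=
  mem_cube.2 fun i =>
    ⟨le_inf (mem_cube.1 hx i).1 (mem_cube.1 hy i).1, inf_le_left.trans (mem_cube.1 hx i).2⟩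

lemma sup_mem_cube {a b : ℝ} {l : ℕ} {x y : Fin l → ℝ} (hx : x ∈ cube (Set.Icc a b) l)
    (hy : y ∈ cube (Set.Icc a b) l) : x ⊔ y ∈ cube (Set.Icc a b) l :=
  mem_cube.2 fun i =>
    ⟨(mem_cube.1 hx i).1.trans le_sup_left, sup_le (mem_cube.1 hx i).2 (mem_cube.1 hy i).2⟩

lemma uniqueDiffOn_cube {a b : ℝ} (hab : a < b) (l : ℕ) :
    UniqueDiffOn ℝ (cube (Set.Icc a b) l) := by
  refine uniqueDiffOn_convex (convex_cube (convex_Icc a b) l) ?_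
  refine ⟨fun _ => (a + b) / 2, ?_⟩
  rw [cube, interior_pi_set Set.finite_univ]
  intro i _
  rw [interior_Icc]
  constructor <;> linarith

lemma hasDerivWithinAt_line {E : Type*} [NormedAddCommGroup E] [NormedSpace ℝ E] {S : Set E}
    {f : E → ℝ} (hf : DifferentiableOn ℝ f S) {x v : E}
    (hS : ∀ s ∈ Set.Icc (0 : ℝ) 1, x + s • v ∈ S) {s : ℝ} (hs : s ∈ Set.Icc (0 : ℝ) 1) :
    HasDerivWithinAt (fun r : ℝ => f (x + r • v)) (fderivWithin ℝ f S (x + s • v) v)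
      (Set.Icc 0 1) s := by
  have h1 : HasDerivWithinAt (fun r : ℝ => x + r • v) v (Set.Icc 0 1) s := by
    simpa using (((hasDerivAt_id s).smul_const v).const_add x).hasDerivWithinAt
  exact (hf _ (hS s hs)).hasFDerivWithinAt.comp_hasDerivWithinAt s h1 hS

lemma le_of_hasDerivWithinAt_nonpos {φ φ' : ℝ → ℝ}
    (h : ∀ s ∈ Set.Icc (0 : ℝ) 1, HasDerivWithinAt φ (φ' s) (Set.Icc 0 1) s)
    (h' : ∀ s ∈ Set.Icc (0 : ℝ) 1, φ' s ≤ 0) : φ 1 ≤ φ 0 := by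
  have : AntitoneOn φ (Set.Icc 0 1) :=
    antitoneOn_of_hasDerivWithinAt_nonpos (convex_Icc 0 1)
      (fun s hs => (h s hs).continuousWithinAt)
      (fun s hs => (h s (interior_subset hs)).mono interior_subset)
      (fun s hs => h' s (interior_subset hs))
  exact this (by simp) (by simp) zero_le_one

lemma clm_apply_eq_sum {l : ℕ} (L : (Fin l → ℝ) →L[ℝ] ℝ) (v : Fin l → ℝ) :
    L v = ∑ i, v i * L (Pi.single i 1) := by
  conv_lhs => rw [pi_eq_sum_univ' v, map_sum]
  refine Finset.sum_congr rfl fun i _ => ?_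
  rw [map_smul, smul_eq_mul]

/-- Nonpositive mixed second derivatives make the `i`-th partial derivative nonincreasing in
directions that do not change the `i`-th coordinate. -/
lemma partialWithin_le_of_le {a b : ℝ} (hab : a < b) {l : ℕ} {c : (Fin l → ℝ) → ℝ}
    (hc2 : ContDiffOn ℝ 2 c (cube (Set.Icc a b) l))
    (hneg : ∀ i j : Fin l, i ≠ j → ∀ x ∈ cube (Set.Icc a b) l,
      partialWithin (cube (Set.Icc a b) l) i
        (partialWithin (cube (Set.Icc a b) l) j c) x ≤ 0)
    {i : Fin l} {x w : Fin l → ℝ} (hx : x ∈ cube (Set.Icc a b) l)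
    (hxw : x + w ∈ cube (Set.Icc a b) l) (hw : 0 ≤ w) (hi : w i = 0) :
    partialWithin (cube (Set.Icc a b) l) i c (x + w) ≤
      partialWithin (cube (Set.Icc a b) l) i c x := by
  set S := cube (Set.Icc a b) l with hS
  have hd : DifferentiableOn ℝ (partialWithin S i c) S := by
    have h1 : ContDiffOn ℝ 1 (fderivWithin ℝ c S) S :=
      hc2.fderivWithin (uniqueDiffOn_cube hab l) (by norm_num)
    exact (h1.clm_apply contDiffOn_const).differentiableOn (by norm_num)
  have hline : ∀ s ∈ Set.Icc (0 : ℝ) 1, x + s • w ∈ S := fun s hs =>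
    (convex_cube (convex_Icc a b) l).add_smul_mem hx hxw hs
  have := le_of_hasDerivWithinAt_nonpos (fun s hs => hasDerivWithinAt_line hd hline hs) ?_
  · simpa using this
  · intro s hs
    rw [clm_apply_eq_sum]
    refine Finset.sum_nonpos fun j _ => ?_
    by_cases hji : j = i
    · simp [hji, hi]
    · exact mul_nonpos_of_nonneg_of_nonpos (hw j) (hneg j i hji _ (hline s hs))

theorem submodularOn_of_partialWithin_nonpos {a b : ℝ} (hab : a < b) {l : ℕ}
    {c : (Fin l → ℝ) → ℝ}
    (hc2 : ContDiffOn ℝ 2 c (cube (Set.Icc a b) l))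
    (hneg : ∀ i j : Fin l, i ≠ j → ∀ x ∈ cube (Set.Icc a b) l,
      partialWithin (cube (Set.Icc a b) l) i
        (partialWithin (cube (Set.Icc a b) l) j c) x ≤ 0) :
    SubmodularOn (cube (Set.Icc a b) l) c := by
  intro x hx y hy
  set S := cube (Set.Icc a b) l with hS
  have hSc : Convex ℝ S := convex_cube (convex_Icc a b) l
  have hm : x ⊓ y ∈ S := inf_mem_cube hx hy
  have hM : x ⊔ y ∈ S := sup_mem_cube hx hy
  -- `v` and `w` are nonnegative with disjoint supports
  set m := x ⊓ y with hmdef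
  set v := x - m with hv
  set w := y - m with hw
  have hv0 : 0 ≤ v := sub_nonneg.2 inf_le_left
  have hw0 : 0 ≤ w := sub_nonneg.2 inf_le_right
  have hdisj : ∀ i, v i = 0 ∨ w i = 0 := fun i => by
    simp only [hv, hw, hmdef, Pi.sub_apply, Pi.inf_apply]
    rcases le_total (x i) (y i) with h | h <;> simp [h]
  have hmv : m + v = x := by simp [hv]
  have hmw : m + w = y := by simp [hw]
  have hmvw : m + w + v = x ⊔ y := by
    rw [hmw, hv, hmdef]
    have := inf_add_sup x y
    rw [← add_sub_assoc, add_comm y x, ← this, add_sub_cancel_left]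
  have hcd : DifferentiableOn ℝ c S := hc2.differentiableOn (by norm_num)
  have hl1 : ∀ s ∈ Set.Icc (0 : ℝ) 1, m + s • v ∈ S := fun s hs =>
    hSc.add_smul_mem hm (by rwa [hmv]) hs
  have hl2 : ∀ s ∈ Set.Icc (0 : ℝ) 1, m + w + s • v ∈ S := fun s hs =>
    hSc.add_smul_mem (by rwa [hmw]) (by rwa [hmvw]) hs
  have key := le_of_hasDerivWithinAt_nonpos
    (fun s hs => (hasDerivWithinAt_line hcd hl2 hs).sub (hasDerivWithinAt_line hcd hl1 hs)) ?_
  · simp only [Pi.sub_apply, one_smul, zero_smul, add_zero, hmvw, hmv] at key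
    rw [hmw] at key
    linarith
  · intro s hs
    rw [clm_apply_eq_sum, clm_apply_eq_sum, ← Finset.sum_sub_distrib]
    refine Finset.sum_nonpos fun i _ => ?_
    rcases hdisj i with h | h
    · simp [h]
    · rw [← mul_sub]
      refine mul_nonpos_of_nonneg_of_nonpos (hv0 i) (sub_nonpos.2 ?_)
      have h2 := hl2 s hs
      rw [add_right_comm] at h2 ⊢
      exact partialWithin_le_of_le hab hc2 hneg (hl1 s hs) h2 hw0 h

/-! ### Potentials for submodular functions on a grid -/

/-- The points of the staircase path in `ℕ ^ l`: from `(k, …, k)` the coordinates are increased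
to `k + 1` one after the other, and the first `j` of them have been increased. -/
def staircase (l k j : ℕ) : Fin l → ℕ := fun i => if i.val < j then k + 1 else k

lemma staircase_zero (l k : ℕ) : staircase l k 0 = fun _ => k := by
  ext i; simp [staircase]

lemma staircase_last (l k : ℕ) : staircase l k l = fun _ => k + 1 := by
  ext i; simp [staircase]

/-- The increment of `h` on the step of the staircase path which increases coordinate `j` from
`k` to `k + 1`. -/
def staircaseIncr {l : ℕ} (h : (Fin l → ℕ) → ℝ) (k j : ℕ) : ℝ :=
  h (staircase l k (j + 1)) - h (staircase l k j)

/-- Submodularity compares a step of the truncated path `w ⊓ staircase` with the same step of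
the staircase path. -/
lemma ite_staircaseIncr_le {l : ℕ} {h : (Fin l → ℕ) → ℝ} (hh : SubmodularOn Set.univ h)
    (w : Fin l → ℕ) (k : ℕ) (i : Fin l) :
    (if k < w i then staircaseIncr h k i else 0) ≤
      h (w ⊓ staircase l k (i + 1)) - h (w ⊓ staircase l k i) := by
  split_ifs with hk
  · have h1 := hh (w ⊓ staircase l k (i + 1)) trivial (staircase l k i) trivial
    have e1 : w ⊓ staircase l k (i + 1) ⊓ staircase l k i = w ⊓ staircase l k i := by
      ext j
      simp only [staircase, Pi.inf_apply]
      split_ifs <;> omega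
    have e2 : w ⊓ staircase l k (i + 1) ⊔ staircase l k i = staircase l k (i + 1) := by
      ext j
      by_cases hj : j = i
      · subst hj
        simp only [staircase, Pi.inf_apply, Pi.sup_apply]
        split_ifs <;> omega
      · have : (j : ℕ) ≠ i := fun e => hj (Fin.ext e)
        simp only [staircase, Pi.inf_apply, Pi.sup_apply]
        split_ifs <;> omega
    rw [e1, e2] at h1
    rw [staircaseIncr]
    linarith
  · have : w ⊓ staircase l k (i + 1) = w ⊓ staircase l k i := by
      ext j
      by_cases hj : j = i
      · subst hj
        simp only [staircase, Pi.inf_apply]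
        split_ifs <;> omega
      · have : (j : ℕ) ≠ i := fun e => hj (Fin.ext e)
        simp only [staircase, Pi.inf_apply]
        split_ifs <;> omega
    rw [this, sub_self]

/-- Dual potentials: a submodular function on `ℕ ^ l` is bounded below by a separable function
with equality on the diagonal. -/
theorem exists_potentials {l : ℕ} {h : (Fin l → ℕ) → ℝ} (hh : SubmodularOn Set.univ h) :
    ∃ φ : Fin l → ℕ → ℝ, (∀ w, h 0 + ∑ i, φ i (w i) ≤ h w) ∧
      ∀ m, h (fun _ => m) = h 0 + ∑ i, φ i m := by
  have tele : ∀ (f : (Fin l → ℕ) → ℝ) (n : ℕ),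
      ∑ k ∈ Finset.range n, ∑ i : Fin l, (f (staircase l k (i + 1)) - f (staircase l k i)) =
        f (fun _ => n) - f 0 := by
    intro f n
    have : ∀ k, ∑ i : Fin l, (f (staircase l k (i + 1)) - f (staircase l k i)) =
        f (fun _ => k + 1) - f (fun _ => k) := by
      intro k
      rw [Fin.sum_univ_eq_sum_range
        (fun j => f (staircase l k (j + 1)) - f (staircase l k j)) l,
        Finset.sum_range_sub (fun j => f (staircase l k j)), staircase_zero, staircase_last]
    simp_rw [this]
    exact Finset.sum_range_sub (fun k => f (fun _ => k)) n
  refine ⟨fun i m => ∑ k ∈ Finset.range m, staircaseIncr h k i, fun w => ?_, fun m => ?_⟩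
  · obtain ⟨n, hn⟩ : ∃ n, ∀ i, w i ≤ n :=
      ⟨∑ i, w i, fun i => Finset.single_le_sum (fun _ _ => Nat.zero_le _) (Finset.mem_univ i)⟩
    have h1 : ∑ i, ∑ k ∈ Finset.range (w i), staircaseIncr h k i =
        ∑ k ∈ Finset.range n, ∑ i : Fin l, if k < w i then staircaseIncr h k i else 0 := by
      rw [Finset.sum_comm]
      refine Finset.sum_congr rfl fun i _ => ?_
      rw [← Finset.sum_filter]
      congr 1
      ext k
      have := hn i
      simp only [Finset.mem_range, Finset.mem_filter]
      omega
    have h2 := tele (fun x => h (w ⊓ x)) n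
    have e1 : w ⊓ (fun _ => n) = w := inf_eq_left.2 hn
    have e2 : w ⊓ 0 = 0 := inf_eq_right.2 fun _ => Nat.zero_le _
    simp only [e1, e2] at h2
    have h3 : ∑ k ∈ Finset.range n, (∑ i : Fin l, if k < w i then staircaseIncr h k i else 0) ≤
        h w - h 0 := by
      rw [← h2]
      exact Finset.sum_le_sum fun k _ => Finset.sum_le_sum fun i _ => ite_staircaseIncr_le hh w k i
    linarith
  · have h1 := tele h m
    rw [Finset.sum_comm] at h1
    simp only [staircaseIncr]
    linarith

/-! ### Distribution and quantile functions -/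

/-- The uniform distribution on `[0, 1]`. -/
noncomputable abbrev uniform01 : Measure ℝ := volume.restrict (Set.Icc 0 1)

instance : IsProbabilityMeasure uniform01 := ⟨by simp⟩

lemma continuous_cdf (μ : Measure ℝ) [IsProbabilityMeasure μ] (hμ : ∀ x, μ {x} = 0) :
    Continuous (ProbabilityTheory.cdf μ) := by
  refine continuous_iff_continuousAt.2 fun x => ?_
  have hmono := ProbabilityTheory.monotone_cdf μ
  rw [hmono.continuousAt_iff_leftLim_eq_rightLim, StieltjesFunction.rightLim_eq]
  have h1 := (ProbabilityTheory.cdf μ).measure_singleton x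
  rw [ProbabilityTheory.measure_cdf, hμ x, eq_comm, ENNReal.ofReal_eq_zero] at h1
  exact le_antisymm (hmono.leftLim_le le_rfl) (by linarith)

/-- The probability integral transform. -/
lemma map_cdf (μ : Measure ℝ) [IsProbabilityMeasure μ] (hμ : ∀ x, μ {x} = 0) :
    μ.map (ProbabilityTheory.cdf μ) = uniform01 := by
  have hmono := ProbabilityTheory.monotone_cdf μ
  have hcont := continuous_cdf μ hμ
  have : IsProbabilityMeasure (μ.map (ProbabilityTheory.cdf μ)) :=
    Measure.isProbabilityMeasure_map hmono.measurable.aemeasurable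
  refine Measure.ext_of_Iic _ _ fun p => ?_
  rw [Measure.map_apply hmono.measurable measurableSet_Iic,
    Measure.restrict_apply measurableSet_Iic]
  -- the distribution function attains every value in `(0, 1)`
  have hsurj : ∀ q, 0 < q → q < 1 → ∃ x, ProbabilityTheory.cdf μ x = q := fun q h0 h1 =>
    mem_range_of_exists_le_of_exists_ge hcont
      (((ProbabilityTheory.tendsto_cdf_atBot μ).eventually (gt_mem_nhds h0)).exists.imp
        fun _ h => h.le)
      (((ProbabilityTheory.tendsto_cdf_atTop μ).eventually (lt_mem_nhds h1)).exists.imp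
        fun _ h => h.le)
  rcases lt_or_ge p 0 with hp0 | hp0
  · have e1 : ProbabilityTheory.cdf μ ⁻¹' Set.Iic p = ∅ := by
      ext x
      have := ProbabilityTheory.cdf_nonneg μ x
      simp only [Set.mem_preimage, Set.mem_Iic, Set.mem_empty_iff_false, iff_false, not_le]
      linarith
    have e2 : Set.Iic p ∩ Set.Icc (0 : ℝ) 1 = ∅ := by
      ext x
      simp only [Set.mem_inter_iff, Set.mem_Iic, Set.mem_Icc, Set.mem_empty_iff_false, iff_false]
      rintro ⟨h1, h2, -⟩
      linarith
    rw [e1, e2]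
    simp
  rcases le_or_gt 1 p with hp1 | hp1
  · have e1 : ProbabilityTheory.cdf μ ⁻¹' Set.Iic p = Set.univ := by
      ext x
      have := ProbabilityTheory.cdf_le_one μ x
      simp only [Set.mem_preimage, Set.mem_Iic, Set.mem_univ, iff_true]
      linarith
    have e2 : Set.Iic p ∩ Set.Icc (0 : ℝ) 1 = Set.Icc 0 1 :=
      Set.inter_eq_right.2 fun x hx => hx.2.trans hp1
    rw [e1, e2]
    simp
  have e2 : Set.Iic p ∩ Set.Icc (0 : ℝ) 1 = Set.Icc 0 p := by
    ext x
    simp only [Set.mem_inter_iff, Set.mem_Iic, Set.mem_Icc]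
    constructor
    · rintro ⟨h1, h2, -⟩
      exact ⟨h2, h1⟩
    · rintro ⟨h1, h2⟩
      exact ⟨h2, h1, by linarith⟩
  rw [e2, Real.volume_Icc, sub_zero]
  apply le_antisymm
  · -- compare with the values `q` slightly above `p`
    have hub : ∀ q, p < q → q < 1 →
        μ (ProbabilityTheory.cdf μ ⁻¹' Set.Iic p) ≤ ENNReal.ofReal q := by
      intro q hq hq1
      obtain ⟨x, hx⟩ := hsurj q (hp0.trans_lt hq) hq1
      rw [← hx, ProbabilityTheory.ofReal_cdf]
      refine measure_mono fun y hy => ?_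
      by_contra hxy
      have h1 := hmono (not_le.1 hxy).le
      have h2 : ProbabilityTheory.cdf μ y ≤ p := hy
      linarith
    have hlim : Filter.Tendsto ENNReal.ofReal (nhdsWithin p (Set.Ioi p))
        (nhds (ENNReal.ofReal p)) :=
      (ENNReal.continuous_ofReal.tendsto p).mono_left nhdsWithin_le_nhds
    refine ge_of_tendsto hlim ?_
    filter_upwards [Ioo_mem_nhdsGT hp1] with q hq using hub q hq.1 hq.2
  · rcases hp0.eq_or_lt with rfl | hp
    · simp
    · obtain ⟨x, hx⟩ := hsurj p hp hp1
      rw [← hx, ProbabilityTheory.ofReal_cdf]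
      exact measure_mono fun y hy => hmono hy

/-- The quantile function of a measure concentrated on `[a, b]`. The disjunct `x = b` keeps the
set nonempty for every real `p`, so that the function is monotone on all of `ℝ`. -/
noncomputable def quantile (a b : ℝ) (μ : Measure ℝ) (p : ℝ) : ℝ :=
  sInf {x ∈ Set.Icc a b | x = b ∨ p ≤ ProbabilityTheory.cdf μ x}

lemma quantile_bddBelow (a b : ℝ) (μ : Measure ℝ) (p : ℝ) :
    BddBelow {x ∈ Set.Icc a b | x = b ∨ p ≤ ProbabilityTheory.cdf μ x} :=
  ⟨a, fun _ hx => hx.1.1⟩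

lemma quantile_nonempty {a b : ℝ} (hab : a ≤ b) (μ : Measure ℝ) (p : ℝ) :
    {x ∈ Set.Icc a b | x = b ∨ p ≤ ProbabilityTheory.cdf μ x}.Nonempty :=
  ⟨b, ⟨hab, le_rfl⟩, Or.inl rfl⟩

lemma monotone_quantile {a b : ℝ} (hab : a ≤ b) (μ : Measure ℝ) :
    Monotone (quantile a b μ) := fun _ _ hpq =>
  csInf_le_csInf (quantile_bddBelow ..) (quantile_nonempty hab ..)
    fun _ hx => ⟨hx.1, hx.2.imp_right hpq.trans⟩

lemma quantile_mem {a b : ℝ} (hab : a ≤ b) (μ : Measure ℝ) (p : ℝ) :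
    quantile a b μ p ∈ Set.Icc a b :=
  ⟨le_csInf (quantile_nonempty hab ..) fun _ hx => hx.1.1,
    csInf_le (quantile_bddBelow ..) ⟨⟨hab, le_rfl⟩, Or.inl rfl⟩⟩

lemma ae_quantile_cdf {a b : ℝ} (μ : Measure ℝ) [IsProbabilityMeasure μ]
    (hμ : ∀ x, μ {x} = 0) (hμab : μ (Set.Icc a b)ᶜ = 0) :
    ∀ᵐ x ∂μ, quantile a b μ (ProbabilityTheory.cdf μ x) = x := by
  have hmono := ProbabilityTheory.monotone_cdf μ
  -- the identity fails only where the distribution function is constant on the left of `x`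
  have hflat : ∀ r : ℚ, ∀ᵐ x ∂μ, ProbabilityTheory.cdf μ x ≠ ProbabilityTheory.cdf μ r := by
    intro r
    refine ae_of_ae_map (p := fun y => y ≠ ProbabilityTheory.cdf μ r)
      hmono.measurable.aemeasurable ?_
    rw [map_cdf μ hμ]
    exact Measure.ae_ne _ _
  have hmem : ∀ᵐ x ∂μ, x ∈ Set.Icc a b := hμab
  filter_upwards [ae_all_iff.2 hflat, hmem] with x hx hxab
  apply le_antisymm
  · exact csInf_le (quantile_bddBelow ..) ⟨hxab, Or.inr le_rfl⟩
  · refine le_csInf ⟨x, hxab, Or.inr le_rfl⟩ fun y hy => ?_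
    by_contra hyx
    rw [not_le] at hyx
    rcases hy.2 with rfl | h
    · exact absurd hxab.2 (not_le.2 hyx)
    · obtain ⟨r, hr1, hr2⟩ := exists_rat_btwn hyx
      exact hx r (le_antisymm (h.trans (hmono hr1.le)) (hmono hr2.le))

lemma map_quantile {a b : ℝ} (hab : a ≤ b) (μ : Measure ℝ) [IsProbabilityMeasure μ]
    (hμ : ∀ x, μ {x} = 0) (hμab : μ (Set.Icc a b)ᶜ = 0) :
    uniform01.map (quantile a b μ) = μ := by
  rw [← map_cdf μ hμ, Measure.map_map (monotone_quantile hab μ).measurable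
    (ProbabilityTheory.monotone_cdf μ).measurable]
  conv_rhs => rw [← Measure.map_id (μ := μ)]
  exact Measure.map_congr (ae_quantile_cdf μ hμ hμab)

/-! ### Optimality of the comonotone coupling -/

/-- The grid approximations `Q i (⌊n u⌋ / n)` may replace `Q i u` under the integral in the limit,
because a monotone function has at most countably many discontinuities. -/
lemma tendsto_integral_grid {Y : Type*} [MeasurableSpace Y] (P : Measure Y)
    [IsProbabilityMeasure P] {l : ℕ} {a b : ℝ} {Q : Fin l → ℝ → ℝ}
    (hQ : ∀ i, Monotone (Q i)) (hQm : ∀ i p, Q i p ∈ Set.Icc a b) {U : Fin l → Y → ℝ}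
    (hU : ∀ i, Measurable (U i)) (hUP : ∀ i, P.map (U i) = uniform01)
    {C : (Fin l → ℝ) → ℝ} (hC : Continuous C) :
    Filter.Tendsto (fun n : ℕ => ∫ y, C (fun i => Q i ((⌊(n : ℝ) * U i y⌋₊ : ℝ) / n)) ∂P)
      Filter.atTop (nhds (∫ y, C (fun i => Q i (U i y)) ∂P)) := by
  obtain ⟨K, hK⟩ := (isCompact_univ_pi fun _ : Fin l => isCompact_Icc (a := a) (b := b)
    ).exists_bound_of_continuousOn hC.continuousOn
  refine tendsto_integral_of_dominated_convergence (fun _ => K) (fun n => ?_)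
    (integrable_const K) (fun n => Filter.Eventually.of_forall fun y => hK _ fun i _ => hQm i _) ?_
  · refine (hC.measurable.comp (measurable_pi_lambda _ fun i => ?_)).aestronglyMeasurable
    refine (hQ i).measurable.comp (Measurable.div_const ?_ _)
    exact measurable_from_nat.comp (Nat.measurable_floor.comp ((hU i).const_mul _))
  · have h1 : ∀ i, ∀ᵐ y ∂P, 0 ≤ U i y ∧ ContinuousAt (Q i) (U i y) := by
      intro i
      refine ae_of_ae_map (p := fun u => 0 ≤ u ∧ ContinuousAt (Q i) u) (hU i).aemeasurable ?_
      rw [hUP i]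
      have h2 : ∀ᵐ u ∂uniform01, ContinuousAt (Q i) u :=
        (hQ i).countable_not_continuousAt.measure_zero _
      filter_upwards [h2, ae_restrict_mem measurableSet_Icc] with u hu hu' using ⟨hu'.1, hu⟩
    filter_upwards [ae_all_iff.2 h1] with y hy
    refine (hC.tendsto _).comp (tendsto_pi_nhds.2 fun i => (hy i).2.tendsto.comp ?_)
    have h3 := (tendsto_nat_floor_mul_div_atTop (hy i).1).comp
      (tendsto_natCast_atTop_atTop (R := ℝ))
    simpa [Function.comp_def, mul_comm] using h3

/-- Among all couplings `U` of uniform distributions, the comonotone one minimizes the integral of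
a submodular cost. -/
theorem integral_comonotone_le {Y : Type*} [MeasurableSpace Y] (P : Measure Y)
    [IsProbabilityMeasure P] {l : ℕ} {a b : ℝ} {Q : Fin l → ℝ → ℝ}
    (hQ : ∀ i, Monotone (Q i)) (hQm : ∀ i p, Q i p ∈ Set.Icc a b) {U : Fin l → Y → ℝ}
    (hU : ∀ i, Measurable (U i)) (hUP : ∀ i, P.map (U i) = uniform01)
    {C : (Fin l → ℝ) → ℝ} (hC : Continuous C) (hsub : SubmodularOn (cube (Set.Icc a b) l) C) :
    ∫ s, C (fun i => Q i s) ∂uniform01 ≤ ∫ y, C (fun i => Q i (U i y)) ∂P := by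
  refine le_of_tendsto_of_tendsto'
    (tendsto_integral_grid uniform01 hQ hQm (U := fun _ => id) (fun _ => measurable_id)
      (fun _ => Measure.map_id) hC)
    (tendsto_integral_grid P hQ hQm hU hUP hC) fun n => ?_
  set h : (Fin l → ℕ) → ℝ := fun w => C (fun i => Q i ((w i : ℝ) / n)) with hh
  have hmono : ∀ i, Monotone fun m : ℕ => Q i ((m : ℝ) / n) := fun i p q hpq =>
    hQ i (by gcongr)
  have hsubh : SubmodularOn Set.univ h := by
    intro x _ y _
    have := hsub (fun i => Q i ((x i : ℝ) / n)) (mem_cube.2 fun i => hQm i _)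
      (fun i => Q i ((y i : ℝ) / n)) (mem_cube.2 fun i => hQm i _)
    convert this using 3
    · ext i; exact (hmono i).map_inf _ _
    · ext i; exact (hmono i).map_sup _ _
  obtain ⟨φ, hφ, hφd⟩ := exists_potentials hsubh
  have hfl : Measurable fun u : ℝ => ⌊(n : ℝ) * u⌋₊ :=
    Nat.measurable_floor.comp (measurable_id.const_mul _)
  have hφm : ∀ i, Measurable fun u : ℝ => φ i ⌊(n : ℝ) * u⌋₊ := fun i =>
    measurable_from_nat.comp hfl
  have hφi : ∀ i, Integrable (fun u : ℝ => φ i ⌊(n : ℝ) * u⌋₊) uniform01 := by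
    intro i
    refine Integrable.of_bound (hφm i).aestronglyMeasurable
      (∑ k ∈ Finset.range (n + 1), |φ i k|) ?_
    filter_upwards [ae_restrict_mem measurableSet_Icc] with u hu
    have : ⌊(n : ℝ) * u⌋₊ ≤ n := Nat.floor_le_of_le (by nlinarith [hu.2, n.cast_nonneg (α := ℝ)])
    exact Finset.single_le_sum (f := fun k => |φ i k|) (fun _ _ => abs_nonneg _)
      (Finset.mem_range.2 (Nat.lt_succ_of_le this))
  have hφP : ∀ i, Integrable (fun y => φ i ⌊(n : ℝ) * U i y⌋₊) P := fun i => by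
    have := hφi i
    rw [← hUP i] at this
    exact this.comp_measurable (hU i)
  have hφeq : ∀ i, ∫ y, φ i ⌊(n : ℝ) * U i y⌋₊ ∂P = ∫ u, φ i ⌊(n : ℝ) * u⌋₊ ∂uniform01 := by
    intro i
    rw [← hUP i, integral_map (hU i).aemeasurable (hφm i).aestronglyMeasurable]
  calc ∫ s, C (fun i => Q i ((⌊(n : ℝ) * id s⌋₊ : ℝ) / n)) ∂uniform01
      = ∫ s, (h 0 + ∑ i, φ i ⌊(n : ℝ) * s⌋₊) ∂uniform01 :=
        integral_congr_ae (Filter.Eventually.of_forall fun s => hφd ⌊(n : ℝ) * s⌋₊)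
    _ = h 0 + ∑ i, ∫ s, φ i ⌊(n : ℝ) * s⌋₊ ∂uniform01 := by
        rw [integral_add (integrable_const _) (integrable_finsetSum _ fun i _ => hφi i),
          integral_finsetSum _ fun i _ => hφi i]
        simp
    _ = ∫ y, (h 0 + ∑ i, φ i ⌊(n : ℝ) * U i y⌋₊) ∂P := by
        rw [integral_add (integrable_const _) (integrable_finsetSum _ fun i _ => hφP i),
          integral_finsetSum _ fun i _ => hφP i]
        simp [hφeq]
    _ ≤ ∫ y, C (fun i => Q i ((⌊(n : ℝ) * U i y⌋₊ : ℝ) / n)) ∂P := by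
        obtain ⟨K, hK⟩ := (isCompact_univ_pi fun _ : Fin l => isCompact_Icc (a := a) (b := b)
          ).exists_bound_of_continuousOn hC.continuousOn
        refine integral_mono ((integrable_const _).add (integrable_finsetSum _ fun i _ => hφP i))
          (Integrable.of_bound ?_ K (Filter.Eventually.of_forall fun y => hK _ fun i _ => hQm i _))
          fun y => hφ fun i => ⌊(n : ℝ) * U i y⌋₊
        refine (hC.measurable.comp (measurable_pi_lambda _ fun i => ?_)).aestronglyMeasurable
        exact (hmono i).measurable.comp (hfl.comp (hU i))

/-! ### Transport values in terms of quantile functions -/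

lemma measure_singleton_eq_zero {Ω : Set ℝ} (ρ : ProbAC Ω) (x : ℝ) :
    (ρ.1 : Measure ℝ) {x} = 0 :=
  ρ.2.2 Real.volume_singleton

/-- The quantile function of an absolutely continuous measure on `[a, b]`. -/
noncomputable abbrev quantileFun {a b : ℝ} (ρ : ProbAC (Set.Icc a b)) : ℝ → ℝ :=
  quantile a b (ρ.1 : Measure ℝ)

lemma integrable_comp_quantile {a b : ℝ} (hab : a ≤ b) {l : ℕ} {C : (Fin l → ℝ) → ℝ}
    (hC : Continuous C) (ρ : Fin l → ProbAC (Set.Icc a b)) :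
    Integrable (fun s => C fun i => quantileFun (ρ i) s) uniform01 := by
  obtain ⟨K, hK⟩ := (isCompact_univ_pi fun _ : Fin l => isCompact_Icc (a := a) (b := b)
    ).exists_bound_of_continuousOn hC.continuousOn
  refine Integrable.of_bound ?_ K
    (Filter.Eventually.of_forall fun s => hK _ fun i _ => quantile_mem hab _ _)
  exact (hC.measurable.comp (measurable_pi_lambda _ fun i =>
    (monotone_quantile hab _).measurable)).aestronglyMeasurable

/-- Among all random vectors with marginals `ρ i`, the vector of quantile functions minimizes the
integral of a submodular cost. -/
theorem integral_quantile_le {Y : Type*} [MeasurableSpace Y] (P : Measure Y)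
    [IsProbabilityMeasure P] {a b : ℝ} (hab : a ≤ b) {l : ℕ}
    (ρ : Fin l → ProbAC (Set.Icc a b)) {X : Fin l → Y → ℝ} (hX : ∀ i, Measurable (X i))
    (hXρ : ∀ i, P.map (X i) = (ρ i).1) {C : (Fin l → ℝ) → ℝ} (hC : Continuous C)
    (hsub : SubmodularOn (cube (Set.Icc a b) l) C) :
    ∫ s, C (fun i => quantileFun (ρ i) s) ∂uniform01 ≤ ∫ y, C (fun i => X i y) ∂P := by
  have hcdf : ∀ i, Measurable (ProbabilityTheory.cdf ((ρ i).1 : Measure ℝ)) := fun i =>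
    (ProbabilityTheory.monotone_cdf _).measurable
  have hae : ∀ i, ∀ᵐ y ∂P,
      quantileFun (ρ i) (ProbabilityTheory.cdf ((ρ i).1 : Measure ℝ) (X i y)) = X i y := fun i => by
    refine ae_of_ae_map
      (p := fun t => quantileFun (ρ i) (ProbabilityTheory.cdf ((ρ i).1 : Measure ℝ) t) = t)
      (hX i).aemeasurable ?_
    rw [hXρ i]
    exact ae_quantile_cdf _ (measure_singleton_eq_zero (ρ i)) (ρ i).2.1
  -- the variables `F i (X i)` are uniform, and `X i` is recovered from them by the quantile function
  refine (integral_comonotone_le P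
    (fun i => monotone_quantile hab ((ρ i).1 : Measure ℝ)) (fun i => quantile_mem hab _)
    (U := fun i y => ProbabilityTheory.cdf ((ρ i).1 : Measure ℝ) (X i y))
    (fun i => (hcdf i).comp (hX i)) (fun i => ?_) hC hsub).trans_eq (integral_congr_ae ?_)
  · rw [← map_cdf ((ρ i).1 : Measure ℝ) (measure_singleton_eq_zero (ρ i))]
    conv_rhs => arg 2; rw [← hXρ i]
    rw [Measure.map_map (hcdf i) (hX i)]
    rfl
  · filter_upwards [ae_all_iff.2 hae] with y hy
    exact congrArg C (funext hy)

theorem multiMarginal_eq_integral_quantile {a b : ℝ} (hab : a ≤ b) {l : ℕ}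
    {c C : (Fin l → ℝ) → ℝ} (hC : Continuous C) (hCc : Set.EqOn C c (cube (Set.Icc a b) l))
    (hsub : SubmodularOn (cube (Set.Icc a b) l) C) (ρ : Fin l → ProbAC (Set.Icc a b)) :
    multiMarginal (Set.Icc a b) c ρ = ∫ s, C (fun i => quantileFun (ρ i) s) ∂uniform01 := by
  have hcube : MeasurableSet (cube (Set.Icc a b) l) :=
    MeasurableSet.univ_pi fun _ => measurableSet_Icc
  -- plans are concentrated on the cube, where `c = C`
  have hint : ∀ γ ∈ MultiPlans (fun i => (ρ i).1),
      ∫ x in cube (Set.Icc a b) l, c x ∂(γ : Measure (Fin l → ℝ)) =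
        ∫ x, C x ∂(γ : Measure (Fin l → ℝ)) := by
    intro γ hγ
    rw [← setIntegral_congr_fun hcube hCc, Measure.restrict_eq_self_of_ae_mem]
    have : ∀ i, ∀ᵐ x ∂(γ : Measure (Fin l → ℝ)), x i ∈ Set.Icc a b := fun i => by
      refine ae_of_ae_map (f := fun x : Fin l → ℝ => x i) (p := fun t => t ∈ Set.Icc a b)
        (measurable_pi_apply i).aemeasurable ?_
      rw [hγ i]
      exact (ρ i).2.1
    filter_upwards [ae_all_iff.2 this] with x hx using mem_cube.2 hx
  have hQm : Measurable fun s (i : Fin l) => quantileFun (ρ i) s :=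
    measurable_pi_lambda _ fun i => (monotone_quantile hab _).measurable
  refine IsLeast.csInf_eq ⟨?_, ?_⟩
  · let γ : ProbabilityMeasure (Fin l → ℝ) :=
      ⟨uniform01.map fun s i => quantileFun (ρ i) s,
        Measure.isProbabilityMeasure_map hQm.aemeasurable⟩
    have hγ : γ ∈ MultiPlans (fun i => (ρ i).1) := fun i => by
      change (uniform01.map fun s i => quantileFun (ρ i) s).map (fun x => x i) = _
      rw [Measure.map_map (measurable_pi_apply i) hQm]
      exact map_quantile hab _ (measure_singleton_eq_zero (ρ i)) (ρ i).2.1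
    refine ⟨γ, hγ, ?_⟩
    simp only
    rw [hint γ hγ]
    exact integral_map hQm.aemeasurable hC.aestronglyMeasurable
  · rintro _ ⟨γ, hγ, rfl⟩
    simp only
    rw [hint γ hγ]
    exact integral_quantile_le (γ : Measure (Fin l → ℝ)) hab ρ
      (fun i => measurable_pi_apply i) hγ hC hsub

lemma submodularOn_sq_sub (S : Set (Fin 2 → ℝ)) :
    SubmodularOn S fun x => |x 0 - x 1| ^ 2 := by
  intro x _ y _
  simp only [sq_abs, Pi.inf_apply, Pi.sup_apply]
  rcases le_total (x 0) (y 0) with h0 | h0 <;> rcases le_total (x 1) (y 1) with h1 | h1 <;>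
    simp only [h0, h1, inf_of_le_left, inf_of_le_right, sup_of_le_left, sup_of_le_right] <;>
    nlinarith [mul_nonneg (sub_nonneg.2 h0) (sub_nonneg.2 h1)]

/-- In one dimension `W2` is the `L²` distance of the quantile functions. -/
theorem W2_sq_eq_integral_quantile {a b : ℝ} (hab : a ≤ b) (μ ν : ProbAC (Set.Icc a b)) :
    W2 μ.1 ν.1 ^ 2 = ∫ s, (quantileFun μ s - quantileFun ν s) ^ 2 ∂uniform01 := by
  have hμm : Measurable (quantileFun μ) := (monotone_quantile hab _).measurable
  have hνm : Measurable (quantileFun ν) := (monotone_quantile hab _).measurable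
  have hQm : Measurable fun s => (quantileFun μ s, quantileFun ν s) := hμm.prodMk hνm
  have hC : Continuous fun p : ℝ × ℝ => |p.1 - p.2| ^ 2 := by fun_prop
  have hleast : IsLeast ((fun γ : ProbabilityMeasure (ℝ × ℝ) =>
      ∫ p, |p.1 - p.2| ^ 2 ∂(γ : Measure (ℝ × ℝ))) '' Plans μ.1 ν.1)
      (∫ s, |quantileFun μ s - quantileFun ν s| ^ 2 ∂uniform01) := by
    refine ⟨?_, ?_⟩
    · refine ⟨⟨uniform01.map fun s => (quantileFun μ s, quantileFun ν s),
        Measure.isProbabilityMeasure_map hQm.aemeasurable⟩, ⟨?_, ?_⟩, ?_⟩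
      · change (uniform01.map fun s => (quantileFun μ s, quantileFun ν s)).map Prod.fst = _
        rw [Measure.map_map measurable_fst hQm]
        exact map_quantile hab _ (measure_singleton_eq_zero μ) μ.2.1
      · change (uniform01.map fun s => (quantileFun μ s, quantileFun ν s)).map Prod.snd = _
        rw [Measure.map_map measurable_snd hQm]
        exact map_quantile hab _ (measure_singleton_eq_zero ν) ν.2.1
      · exact integral_map hQm.aemeasurable hC.aestronglyMeasurable
    · rintro _ ⟨γ, ⟨h1, h2⟩, rfl⟩
      exact integral_quantile_le (γ : Measure (ℝ × ℝ)) hab ![μ, ν] (X := ![Prod.fst, Prod.snd])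
        (Fin.forall_fin_two.2 ⟨measurable_fst, measurable_snd⟩) (Fin.forall_fin_two.2 ⟨h1, h2⟩)
        (C := fun x => |x 0 - x 1| ^ 2) (by fun_prop) (submodularOn_sq_sub _)
  rw [W2, hleast.csInf_eq, Real.sq_sqrt (integral_nonneg fun s => by positivity)]
  simp only [sq_abs]

/-! ### Geodesics and convexity -/

/-- Equality in the triangle inequality in the Hilbert space `L²(0, 1)`: along a constant speed
geodesic the quantile functions are interpolated linearly. -/
theorem IsConstSpeedGeodesic.quantile_ae_eq {a b : ℝ} (hab : a ≤ b)
    {μ : ℝ → ProbAC (Set.Icc a b)} (hμ : IsConstSpeedGeodesic μ) {t : ℝ}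
    (ht : t ∈ Set.Icc (0 : ℝ) 1) :
    ∀ᵐ s ∂uniform01,
      quantileFun (μ t) s = (1 - t) * quantileFun (μ 0) s + t * quantileFun (μ 1) s := by
  have hint : ∀ p q : ProbAC (Set.Icc a b),
      Integrable (fun s => (quantileFun p s - quantileFun q s) ^ 2) uniform01 := fun p q => by
    simpa using integrable_comp_quantile hab (C := fun x : Fin 2 → ℝ => (x 0 - x 1) ^ 2)
      (by fun_prop) ![p, q]
  have h0 := W2_sq_eq_integral_quantile hab (μ t) (μ 0)
  have h1 := W2_sq_eq_integral_quantile hab (μ t) (μ 1)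
  have h01 := W2_sq_eq_integral_quantile hab (μ 0) (μ 1)
  rw [hμ t ht 0 (by simp), mul_pow, sq_abs] at h0
  rw [hμ t ht 1 (by simp), mul_pow, sq_abs] at h1
  -- the squared distance to the linear interpolation, expanded in the three known distances
  have hid : (fun s => (quantileFun (μ t) s -
        ((1 - t) * quantileFun (μ 0) s + t * quantileFun (μ 1) s)) ^ 2) =
      fun s => (1 - t) * (quantileFun (μ t) s - quantileFun (μ 0) s) ^ 2 +
        t * (quantileFun (μ t) s - quantileFun (μ 1) s) ^ 2 -
        t * (1 - t) * (quantileFun (μ 0) s - quantileFun (μ 1) s) ^ 2 := by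
    funext s
    ring
  have i0 := (hint (μ t) (μ 0)).const_mul (1 - t)
  have i1 := (hint (μ t) (μ 1)).const_mul t
  have i01 := (hint (μ 0) (μ 1)).const_mul (t * (1 - t))
  have hzero : ∫ s, (quantileFun (μ t) s -
      ((1 - t) * quantileFun (μ 0) s + t * quantileFun (μ 1) s)) ^ 2 ∂uniform01 = 0 := by
    rw [hid]
    refine (integral_sub (i0.add i1) i01).trans ?_
    rw [integral_add' i0 i1, integral_const_mul,
      integral_const_mul, integral_const_mul, ← h0, ← h1, ← h01]
    ring
  rw [integral_eq_zero_iff_of_nonneg (fun s => sq_nonneg _)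
    (by rw [hid]; exact (i0.add i1).sub i01)] at hzero
  filter_upwards [hzero] with s hs
  exact sub_eq_zero.1 (pow_eq_zero_iff two_ne_zero |>.1 hs)

lemma exists_continuous_eqOn_cube {a b : ℝ} (hab : a ≤ b) {l : ℕ} {c : (Fin l → ℝ) → ℝ}
    (hc : ContinuousOn c (cube (Set.Icc a b) l)) :
    ∃ C, Continuous C ∧ Set.EqOn C c (cube (Set.Icc a b) l) := by
  refine ⟨fun x => c fun i => Set.projIcc a b hab (x i), ?_, fun x hx => ?_⟩
  · refine hc.comp_continuous (continuous_pi fun i => ?_) fun x =>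
      mem_cube.2 fun i => Subtype.coe_prop _
    exact continuous_subtype_val.comp (continuous_projIcc.comp (continuous_apply i))
  · simp only
    congr 1
    ext i
    rw [Set.projIcc_of_mem hab (mem_cube.1 hx i)]

/-- A convex set carrying an absolutely continuous probability measure is not a single point. -/
lemma exists_eq_Icc {Ω : Set ℝ} (hΩ : IsCompact Ω) (hΩc : Convex ℝ Ω) (ρ : ProbAC Ω) :
    ∃ a b, a < b ∧ Ω = Set.Icc a b := by
  have hpos : volume Ω ≠ 0 := by
    intro h
    have h1 : (ρ.1 : Measure ℝ) Ω = 0 := ρ.2.2 h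
    have h2 := measure_union_le (μ := (ρ.1 : Measure ℝ)) Ω Ωᶜ
    rw [h1, ρ.2.1, Set.union_compl_self, measure_univ] at h2
    simp at h2
  have hne : Ω.Nonempty := nonempty_of_measure_ne_zero hpos
  have heq := eq_Icc_of_connected_compact ⟨hne, hΩc.isPreconnected⟩ hΩ
  refine ⟨sInf Ω, sSup Ω, ?_, heq⟩
  by_contra hlt
  rw [heq, Real.volume_Icc, ENNReal.ofReal_eq_zero.2 (by linarith)] at hpos
  exact hpos rfl

end OptTransport

theorem mainTheorem3 (Ω : Set ℝ) (hΩ : IsCompact Ω) (hΩc : Convex ℝ Ω) (l : ℕ)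
    (c : (Fin l → ℝ) → ℝ)
    (hc2 : ContDiffOn ℝ 2 c (OptTransport.cube Ω l))
    (hconv : ConvexOn ℝ (OptTransport.cube Ω l) c)
    (hneg : ∀ i j : Fin l, i ≠ j → ∀ x ∈ OptTransport.cube Ω l,
      OptTransport.partialWithin (OptTransport.cube Ω l) i
        (OptTransport.partialWithin (OptTransport.cube Ω l) j c) x ≤ 0) :
    OptTransport.IsGeodesicallyConvex (Ω := Ω) (l := l) 0 (OptTransport.multiMarginal Ω c) := by
  intro μ hμ t ht
  simp only [zero_div, zero_mul, sub_zero]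
  rcases l with _ | l
  · -- without marginals the functional is constant
    have h0 : (fun i => μ i t) = fun i => μ i 0 := Subsingleton.elim _ _
    have h1 : (fun i => μ i 1) = fun i => μ i 0 := Subsingleton.elim _ _
    rw [h0, h1, ← add_mul, sub_add_cancel, one_mul]
  obtain ⟨a, b, hab, rfl⟩ := OptTransport.exists_eq_Icc hΩ hΩc (μ 0 0)
  obtain ⟨C, hC, hCc⟩ := OptTransport.exists_continuous_eqOn_cube hab.le hc2.continuousOn
  have hcsub := OptTransport.submodularOn_of_partialWithin_nonpos hab hc2 hneg
  have hCsub : OptTransport.SubmodularOn (OptTransport.cube (Set.Icc a b) (l + 1)) C := by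
    intro x hx y hy
    rw [hCc hx, hCc hy, hCc (OptTransport.inf_mem_cube hx hy),
      hCc (OptTransport.sup_mem_cube hx hy)]
    exact hcsub x hx y hy
  have hint := fun r => OptTransport.integrable_comp_quantile hab.le hC fun i => μ i r
  simp only [OptTransport.multiMarginal_eq_integral_quantile hab.le hC hCc hCsub]
  rw [← integral_const_mul, ← integral_const_mul,
    ← integral_add ((hint 0).const_mul _) ((hint 1).const_mul _)]
  refine integral_mono_ae (hint t) (((hint 0).const_mul _).add ((hint 1).const_mul _)) ?_
  have hae := ae_all_iff.2 fun i => (hμ i).quantile_ae_eq hab.le ht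
  filter_upwards [hae] with s hs
  have hmem : ∀ r, (fun i => OptTransport.quantileFun (μ i r) s) ∈
      OptTransport.cube (Set.Icc a b) (l + 1) := fun r =>
    OptTransport.mem_cube.2 fun i => OptTransport.quantile_mem hab.le _ _
  have key := hconv.2 (hmem 0) (hmem 1) (sub_nonneg.2 ht.2) ht.1 (sub_add_cancel 1 t)
  have e : (fun i => OptTransport.quantileFun (μ i t) s) =
      (1 - t) • (fun i => OptTransport.quantileFun (μ i 0) s) +
        t • fun i => OptTransport.quantileFun (μ i 1) s :=
    funext hs
  simp only [hCc (hmem _)]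
  rw [e]
  exact key
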